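/- Let $\mathbb X\subset\mathbb R^{n_x}$ and $\mathbb U\subset\mathbb R^{n_u}$ be compact, $\mathbb Z=\mathbb X\times\mathbb U$, and let $\mathsf f:\mathbb Z\to\mathbb X$ be continuous (for instance a continuously differentiable control-affine system $\mathsf f(x,u)=f(x)+\sum_{j} g_j(x)u_j$ that maps $\mathbb Z$ into $\mathbb X$). Let $\mu'$ and $\nu$ be finite Borel measures on $\mathbb X$ and $\mathbb Z$ (for instance, $\nu$ a probability distribution of the data). Assume that the control Koopman operator $\mathcal G:L^2_{\mu'}(\mathbb X)\to L^2_\nu(\mathbb Z)$, $\mathcal G y=y\circ\mathsf f$, is well defined and bounded: there is $L$ with $\|\mathcal Gy\|_{L^2_\nu}\le L\|y\|_{L^2_{\mu'}}$ for all $y\in L^2_{\mu'}(\mathbb X)$. Let $\mathcal H_X$ and $\mathcal H_U$ be real reproducing kernel Hilbert spaces (RKHSs) over $\mathbb X$ and $\mathbb U$ with kernels $k_X$ and $k_U$, both universal, i.e. consisting of continuous functions and dense for the supremum norm in $C(\mathbb X)$ and $C(\mathbb U)$, respectively. Let $\mathcal H_Z=\mathcal H_X\oplus(\mathcal H_U\otimes\mathcal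 H_X)$, regarded as the RKHS over $\mathbb Z$ in which $h\oplus(a\otimes b)$ represents the function $(x,u)\mapsto h(x)+a(u)b(x)$ (elements of the direct sum that represent the zero function are factored out); its kernel is $k_Z((x,u),(x',u'))=k_X(x,x')\,(1+k_U(u,u'))$. Assume that $k_X$ and $k_Z$ are continuous. Let $S_{\mu'}:\mathcal H_X\to L^2_{\mu'}(\mathbb X)$ and $S_\nu:\mathcal H_Z\to L^2_\nu(\mathbb Z)$ be the inclusion operators, which send a function to its equivalence class. Then for every observable $y\in\mathcal H_X$ and every $\varepsilon>0$ there is a Hilbert–Schmidt operator $G:\mathcal H_X\to\mathcal H_Z$ such that $$\|\mathcal G S_{\mu'}y-S_\nu Gy\|_{L^2_\nu}<\varepsilon .$$ -/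

import Mathlib

open MeasureTheory
open scoped TensorProduct InnerProductSpace

noncomputable section

namespace ControlKoopman

/-! ### Scalar reproducing kernel Hilbert spaces -/

section Scalar

variable {X : Type*} (H : Type*) [NormedAddCommGroup H] [InnerProductSpace ℝ H] [CompleteSpace H]
  [RKHS ℝ H X ℝ]

/-- The canonical feature map `φ(x) = k(·, x)` of a real-valued RKHS. -/
def feature (x : X) : H := RKHS.kerFun H x (1 : ℝ)

/-- The real-valued reproducing kernel `k(x, x')` of a real-valued RKHS. -/
def scalarKernel (x x' : X) : ℝ := RKHS.kernel H x x' (1 : ℝ)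

/-- The reproducing kernel is a (jointly) continuous function on `X × X`. -/
def HasContinuousKernel [TopologicalSpace X] : Prop :=
  Continuous fun p : X × X => scalarKernel H p.1 p.2

/-- Universality of an RKHS over a compact space: its elements are continuous functions, and they
are dense in the space of all continuous functions for the supremum norm. -/
def IsUniversal [TopologicalSpace X] : Prop :=
  (∀ h : H, Continuous (h : X → ℝ)) ∧
    ∀ φ : X → ℝ, Continuous φ → ∀ ε : ℝ, 0 < ε → ∃ h : H, ∀ x : X, |φ x - h x| < ε

variable {H}

/-- The reproducing property. -/
theorem inner_feature (x : X) (f : H) : ⟪feature H x, f⟫_ℝ = f x := by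
  simp [feature]

theorem scalarKernel_eq_inner (x x' : X) : scalarKernel H x x' = ⟪feature H x, feature H x'⟫_ℝ := by
  rw [inner_feature, feature, RKHS.kerFun_apply, scalarKernel]

theorem continuous_feature [TopologicalSpace X] (hk : HasContinuousKernel H) :
    Continuous (feature H : X → H) := by
  have hk' : Continuous fun p : X × X => scalarKernel H p.1 p.2 := hk
  rw [continuous_iff_continuousAt]
  intro x
  rw [ContinuousAt, tendsto_iff_norm_sub_tendsto_zero]
  have hc : Continuous fun x' : X => √(scalarKernel H x' x' - 2 * scalarKernel H x' x + scalarKernel H x x) := by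
    have h1 : Continuous fun x' : X => scalarKernel H x' x' :=
      Continuous.comp (g := fun p : X × X => scalarKernel H p.1 p.2) (f := fun x' : X => (x', x'))
        hk' (continuous_id.prodMk continuous_id)
    have h2 : Continuous fun x' : X => scalarKernel H x' x :=
      Continuous.comp (g := fun p : X × X => scalarKernel H p.1 p.2) (f := fun x' : X => (x', x))
        hk' (continuous_id.prodMk continuous_const)
    exact ((h1.sub (continuous_const.mul h2)).add continuous_const).sqrt
  have h0 := hc.tendsto x
  have e0 : √(scalarKernel H x x - 2 * scalarKernel H x x + scalarKernel H x x) = 0 := by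
    rw [show scalarKernel H x x - 2 * scalarKernel H x x + scalarKernel H x x = 0 by ring, Real.sqrt_zero]
  rw [e0] at h0
  refine h0.congr fun x' => ?_
  rw [scalarKernel_eq_inner, scalarKernel_eq_inner, scalarKernel_eq_inner, real_inner_self_eq_norm_sq,
    real_inner_self_eq_norm_sq, ← norm_sub_sq_real, Real.sqrt_sq (norm_nonneg _)]

theorem continuous_coe [TopologicalSpace X] (hk : HasContinuousKernel H) (f : H) :
    Continuous (f : X → ℝ) := by
  have h : Continuous fun x : X => ⟪feature H x, f⟫_ℝ :=
    (continuous_feature hk).inner continuous_const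
  simpa only [inner_feature] using h

/-- Elements of an RKHS with continuous kernel over a compact space are square integrable with
respect to every finite Borel measure. -/
theorem memLp_coe [TopologicalSpace X] [CompactSpace X] [MeasurableSpace X]
    [OpensMeasurableSpace X] (μ : Measure X) [IsFiniteMeasure μ]
    (hk : HasContinuousKernel H) (f : H) : MemLp (f : X → ℝ) 2 μ := by
  have hf := continuous_coe hk f
  obtain ⟨C, hC⟩ := isCompact_univ.exists_bound_of_continuousOn hf.continuousOn
  exact MemLp.of_bound hf.measurable.aestronglyMeasurable C
    (Filter.Eventually.of_forall fun x => hC x (Set.mem_univ x))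

/-- The inclusion operator `S_μ : H → L²_μ`, `f ↦ [f]`, of an RKHS with continuous kernel over a
compact space into the square integrable functions of a finite measure. -/
def inclusion [TopologicalSpace X] [CompactSpace X] [MeasurableSpace X]
    [OpensMeasurableSpace X] (μ : Measure X) [IsFiniteMeasure μ]
    (hk : HasContinuousKernel H) : H →ₗ[ℝ] Lp ℝ 2 μ where
  toFun f := (memLp_coe μ hk f).toLp f
  map_add' f g := by
    rw [← MemLp.toLp_add]
    exact MemLp.toLp_congr _ _ (by simp)
  map_smul' c f := by
    rw [RingHom.id_apply, ← MemLp.toLp_const_smul]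
    exact MemLp.toLp_congr _ _ (by simp)

end Scalar

/-! ### The range space `H_X ⊕ (H_U ⊗ H_X)` as an RKHS over `X × U` -/

section Range

variable {X U : Type*} (HX HU : Type*)
  [NormedAddCommGroup HX] [InnerProductSpace ℝ HX] [CompleteSpace HX] [RKHS ℝ HX X ℝ]
  [NormedAddCommGroup HU] [InnerProductSpace ℝ HU] [CompleteSpace HU] [RKHS ℝ HU U ℝ]

/-- The Hilbert space `H_X ⊕ (H_U ⊗ H_X)`: the Hilbert direct sum of `H_X` and of the completed
Hilbert tensor product of `H_U` and `H_X`. -/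
abbrev DirectSumSpace : Type _ :=
  WithLp 2 (HX × UniformSpace.Completion (HU ⊗[ℝ] HX))

/-- The feature `φ_X(x) ⊕ (φ_U(u) ⊗ φ_X(x))` of the point `(x, u)`. -/
def sumFeature (z : X × U) : DirectSumSpace HX HU :=
  WithLp.toLp 2 (feature HX z.1,
    ((feature HU z.2 ⊗ₜ[ℝ] feature HX z.1 : HU ⊗[ℝ] HX) : UniformSpace.Completion (HU ⊗[ℝ] HX)))

/-- The function on `X × U` that an element of `H_X ⊕ (H_U ⊗ H_X)` represents: `f ⊕ (a ⊗ b)`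
represents `(x, u) ↦ f(x) + a(u) b(x)`. -/
def sumEval : DirectSumSpace HX HU →L[ℝ] (X × U → ℝ) :=
  ContinuousLinearMap.pi fun z => innerSL ℝ (sumFeature HX HU z)

/-- `H_Z = H_X ⊕ (H_U ⊗ H_X)` as a Hilbert space of functions on `X × U`. Elements of the direct
sum that represent the zero function (they exist exactly if the function spaces `H_X` and
`H_U ⊗ H_X` overlap) are factored out by passing to the orthogonal complement, as usual for a sum
of RKHSs; otherwise this is the whole direct sum. -/
abbrev RangeSpace : Type _ := ↥((sumEval HX HU).ker)ᗮ

instance instRKHSRangeSpace : RKHS ℝ (RangeSpace HX HU) (X × U) ℝ where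
  coeCLM := (sumEval HX HU) ∘L ((sumEval HX HU).ker)ᗮ.subtypeL
  coeCLM_injective := by
    rw [injective_iff_map_eq_zero]
    intro h h0
    have h1 : (h : DirectSumSpace HX HU) ∈ (sumEval HX HU).ker := h0
    have h2 := (Submodule.mem_orthogonal _ _).1 h.2 _ h1
    exact Subtype.ext (inner_self_eq_zero.1 h2)

variable {HX HU}

theorem sumEval_apply (f : HX) (a : HU) (b : HX) (x : X) (u : U) :
    sumEval HX HU (WithLp.toLp 2 (f, ((a ⊗ₜ[ℝ] b : HU ⊗[ℝ] HX) :
      UniformSpace.Completion (HU ⊗[ℝ] HX)))) (x, u) = f x + a u * b x := by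
  simp [sumEval, sumFeature, WithLp.prod_inner_apply, inner_feature,
    UniformSpace.Completion.inner_coe]

/-- The kernel of `H_Z` is `k_Z((x,u),(x',u')) = k_X(x,x') (1 + k_U(u,u'))`. -/
theorem scalarKernel_rangeSpace (z z' : X × U) :
    scalarKernel (RangeSpace HX HU) z z' = scalarKernel HX z.1 z'.1 * (1 + scalarKernel HU z.2 z'.2) := by
  have hmem : ∀ w : X × U, sumFeature HX HU w ∈ ((sumEval HX HU).ker)ᗮ := by
    intro w
    rw [Submodule.mem_orthogonal']
    intro v hv
    have := congrFun (show sumEval HX HU v = 0 from hv) w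
    simpa [sumEval] using this
  have hfeat : ∀ w : X × U, feature (RangeSpace HX HU) w = ⟨sumFeature HX HU w, hmem w⟩ := by
    intro w
    refine ext_inner_right ℝ fun v => ?_
    rw [inner_feature]
    rfl
  rw [scalarKernel_eq_inner, hfeat, hfeat, Submodule.coe_inner]
  simp only [sumFeature, WithLp.prod_inner_apply, UniformSpace.Completion.inner_coe,
    TensorProduct.inner_tmul, scalarKernel_eq_inner]
  ring

end Range

/-! ### Operators -/

/-- A bounded operator `A` is Hilbert-Schmidt: `∑ ‖A eᵢ‖² < ∞` for an orthonormal basis `(eᵢ)`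
of its domain. -/
def IsHilbertSchmidt {F Y : Type*} [NormedAddCommGroup F] [InnerProductSpace ℝ F]
    [NormedAddCommGroup Y] [InnerProductSpace ℝ Y] (A : F →L[ℝ] Y) : Prop :=
  ∃ (s : Set F) (e : HilbertBasis s ℝ F), Summable fun i : s => ‖A (e i)‖ ^ 2

/-- `𝒢` is the control Koopman operator `L²_μ'(X) → L²_ν(X × U)`, `y ↦ y ∘ f`, of the controlled
dynamics `f : X × U → X`. The condition runs over all representatives `y`, so it contains that the
composition is well defined on equivalence classes. -/
def IsControlKoopman {X U : Type*} [MeasurableSpace X] [MeasurableSpace U] (f : X × U → X)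
    (μ' : Measure X) (ν : Measure (X × U)) (𝒢 : Lp ℝ 2 μ' →ₗ[ℝ] Lp ℝ 2 ν) : Prop :=
  ∀ (y : X → ℝ) (hy : MemLp y 2 μ'), 𝒢 (hy.toLp y) =ᵐ[ν] fun z => y (f z)

end ControlKoopman

end

/-!
The target function `𝒢 [y]` is the class of the continuous function `y ∘ f` on the compact space
`X × U`, so it suffices that `H_Z` is dense in `C(X × U, ℝ)` for the supremum norm, the supremum
norm dominating the `L²` norm of a finite measure up to a constant
(`IsUniversal.exists_norm_sub_inclusion_lt`).

For the density (`isUniversal_rangeSpace`), the Stone–Weierstrass theorem shows that the finite sums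
of products `(x, u) ↦ φ x * ψ u` are dense (`denseRange_productMap`). By universality of `H_X` and
`H_U` each factor can be approximated by an element of the corresponding space, and the product of
`b ∈ H_X` with `a ∈ H_U` is the function represented by `0 ⊕ (a ⊗ b)`, which belongs to `H_Z`.

Once `h ∈ H_Z` is close to `y ∘ f`, an operator with `G y = h` is needed; for `y ≠ 0` the rank-one
operator `v ↦ ‖y‖⁻² ⟪y, v⟫ h` does this, and it is Hilbert–Schmidt by Bessel's inequality.
-/

namespace ControlKoopman

/-- For compact Hausdorff spaces, the finite sums of functions `(x, u) ↦ φ x * ψ u` are uniformly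
dense in the continuous functions on the product. -/
theorem denseRange_productMap {X U : Type*} [TopologicalSpace X] [CompactSpace X] [T2Space X]
    [TopologicalSpace U] [CompactSpace U] [T2Space U] :
    DenseRange (Algebra.TensorProduct.productMap
      (ContinuousMap.compRightAlgHom ℝ ℝ (ContinuousMap.fst : C(X × U, X)))
      (ContinuousMap.compRightAlgHom ℝ ℝ (ContinuousMap.snd : C(X × U, U)))) := by
  set P := Algebra.TensorProduct.productMap
    (ContinuousMap.compRightAlgHom ℝ ℝ (ContinuousMap.fst : C(X × U, X)))
    (ContinuousMap.compRightAlgHom ℝ ℝ (ContinuousMap.snd : C(X × U, U))) with hP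
  have hsep : P.range.SeparatesPoints := by
    rintro ⟨x, u⟩ ⟨x', u'⟩ hne
    by_cases hx : x = x'
    · have hu : u ≠ u' := fun hu => hne (by rw [hx, hu])
      obtain ⟨ψ, hψ, hψne⟩ := separatesPoints_continuous_of_t35Space hu
      exact ⟨_, ⟨P (1 ⊗ₜ ⟨ψ, hψ⟩), ⟨_, rfl⟩, rfl⟩, by simpa [hP] using hψne⟩
    · obtain ⟨φ, hφ, hφne⟩ := separatesPoints_continuous_of_t35Space hx
      exact ⟨_, ⟨P (⟨φ, hφ⟩ ⊗ₜ 1), ⟨_, rfl⟩, rfl⟩, by simpa [hP] using hφne⟩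
  intro g
  exact ContinuousMap.continuousMap_mem_subalgebra_closure_of_separatesPoints _ hsep g

section

variable {X : Type*} {H : Type*} [NormedAddCommGroup H] [InnerProductSpace ℝ H]
  [RKHS ℝ H X ℝ] [TopologicalSpace X]

/-- The continuous functions that belong to the function space `H`, as a subspace of `C(X, ℝ)`. -/
def continuousFunctions (X H : Type*) [NormedAddCommGroup H] [InnerProductSpace ℝ H]
    [RKHS ℝ H X ℝ] [TopologicalSpace X] : Submodule ℝ C(X, ℝ) where
  carrier := {g | ∃ h : H, ⇑h = ⇑g}
  zero_mem' := ⟨0, by simp⟩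
  add_mem' := by
    rintro _ _ ⟨h, hh⟩ ⟨k, hk⟩
    exact ⟨h + k, by simp [hh, hk]⟩
  smul_mem' := by
    rintro c _ ⟨h, hh⟩
    exact ⟨c • h, by simp [hh]⟩

theorem IsUniversal.dense_continuousFunctions [CompactSpace X] (hH : IsUniversal (X := X) H) :
    Dense (continuousFunctions X H : Set C(X, ℝ)) := by
  intro φ
  rw [Metric.mem_closure_iff]
  intro ε hε
  obtain ⟨h, hh⟩ := hH.2 φ φ.continuous ε hε
  exact ⟨⟨h, hH.1 h⟩, ⟨h, rfl⟩, (ContinuousMap.dist_lt_iff hε).2 hh⟩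

theorem isUniversal_of_dense [CompactSpace X] (hc : ∀ h : H, Continuous (h : X → ℝ))
    (hd : Dense (continuousFunctions X H : Set C(X, ℝ))) : IsUniversal (X := X) H := by
  refine ⟨hc, fun φ hφ ε hε => ?_⟩
  obtain ⟨g, ⟨h, hg⟩, hlt⟩ := Metric.mem_closure_iff.1 (hd ⟨φ, hφ⟩) ε hε
  refine ⟨h, fun x => ?_⟩
  rw [hg]
  exact (ContinuousMap.dist_lt_iff hε).1 hlt x

/-- A universal space approximates continuous functions in `L²` of every finite measure. -/
theorem IsUniversal.exists_norm_sub_inclusion_lt [CompleteSpace H] [CompactSpace X]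
    [MeasurableSpace X] [OpensMeasurableSpace X] (μ : Measure X) [IsFiniteMeasure μ]
    (hH : IsUniversal (X := X) H) (hk : HasContinuousKernel (X := X) H) (F : Lp ℝ 2 μ)
    {φ : X → ℝ} (hφ : Continuous φ) (hF : F =ᵐ[μ] φ) {ε : ℝ} (hε : 0 < ε) :
    ∃ h : H, ‖F - inclusion μ hk h‖ < ε := by
  -- `C` bounds the `L²` norm by the supremum norm; the `1` keeps the quotient `ε / (C + 1)` positive.
  set C : ℝ := measureUnivNNReal μ ^ (2 : ENNReal).toReal⁻¹
  have hC : 0 ≤ C := by positivity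
  obtain ⟨h, hh⟩ := hH.2 φ hφ (ε / (C + 1)) (by positivity)
  refine ⟨h, ?_⟩
  have hle : ‖F - inclusion μ hk h‖ ≤ C * (ε / (C + 1)) := by
    refine Lp.norm_le_of_ae_bound (by positivity) ?_
    have hcoe : inclusion μ hk h =ᵐ[μ] h := (memLp_coe μ hk h).coeFn_toLp
    filter_upwards [Lp.coeFn_sub F (inclusion μ hk h), hF, hcoe] with x h1 h2 h3
    rw [h1, Pi.sub_apply, h2, h3]
    exact (hh x).le
  calc ‖F - inclusion μ hk h‖ ≤ C * (ε / (C + 1)) := hle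
    _ < (C + 1) * (ε / (C + 1)) := by gcongr; linarith
    _ = ε := by field_simp

end

section

variable {X U HX HU : Type*}
  [NormedAddCommGroup HX] [InnerProductSpace ℝ HX] [CompleteSpace HX] [RKHS ℝ HX X ℝ]
  [NormedAddCommGroup HU] [InnerProductSpace ℝ HU] [CompleteSpace HU] [RKHS ℝ HU U ℝ]

/-- Passing to the orthogonal complement of the null space loses no represented function. -/
theorem exists_rangeSpace_eq_sumEval (d : DirectSumSpace HX HU) :
    ∃ h : RangeSpace (X := X) (U := U) HX HU, ⇑h = sumEval HX HU d := by
  have hclosed : IsClosed ((sumEval (X := X) (U := U) HX HU).ker : Set (DirectSumSpace HX HU)) :=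
    (sumEval HX HU).isClosed_ker
  have : CompleteSpace (sumEval (X := X) (U := U) HX HU).ker := hclosed.completeSpace_coe
  obtain ⟨v, hv, w, hw, rfl⟩ :=
    (sumEval (X := X) (U := U) HX HU).ker.exists_add_mem_mem_orthogonal d
  refine ⟨⟨w, hw⟩, ?_⟩
  have hv0 : sumEval (X := X) (U := U) HX HU v = 0 := hv
  rw [map_add, hv0, zero_add]
  rfl

theorem exists_rangeSpace_eq_mul (a : HU) (b : HX) :
    ∃ h : RangeSpace (X := X) (U := U) HX HU, ∀ z : X × U, h z = b z.1 * a z.2 := by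
  obtain ⟨h, hh⟩ := exists_rangeSpace_eq_sumEval (X := X) (U := U)
    (WithLp.toLp 2 ((0 : HX), ((a ⊗ₜ[ℝ] b : HU ⊗[ℝ] HX) : UniformSpace.Completion (HU ⊗[ℝ] HX))))
  refine ⟨h, fun z => ?_⟩
  rw [hh, sumEval_apply]
  simp [mul_comm]

variable [TopologicalSpace X] [CompactSpace X] [T2Space X]
  [TopologicalSpace U] [CompactSpace U] [T2Space U]

/-- The space `H_X ⊕ (H_U ⊗ H_X)` inherits universality from `H_X` and `H_U`. -/
theorem isUniversal_rangeSpace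
    (hkZ : HasContinuousKernel (X := X × U) (RangeSpace (X := X) (U := U) HX HU))
    (hHX : IsUniversal (X := X) HX) (hHU : IsUniversal (X := U) HU) :
    IsUniversal (X := X × U) (RangeSpace (X := X) (U := U) HX HU) := by
  refine isUniversal_of_dense (continuous_coe hkZ) ?_
  set S := continuousFunctions (X × U) (RangeSpace (X := X) (U := U) HX HU)
  have hmul : ∀ (φ : C(X, ℝ)) (ψ : C(U, ℝ)),
      φ.comp ContinuousMap.fst * ψ.comp ContinuousMap.snd ∈ S.topologicalClosure := by
    intro φ ψ
    let m : C(X, ℝ) → C(U, ℝ) → C(X × U, ℝ) := fun φ ψ =>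
      φ.comp ContinuousMap.fst * ψ.comp ContinuousMap.snd
    have hcont : Continuous (Function.uncurry m) :=
      ((ContinuousMap.continuous_precomp _).comp continuous_fst).mul
        ((ContinuousMap.continuous_precomp _).comp continuous_snd)
    refine map_mem_closure₂ (f := m) hcont (hHX.dense_continuousFunctions φ)
      (hHU.dense_continuousFunctions ψ) ?_
    rintro g ⟨b, hb⟩ k ⟨a, ha⟩
    obtain ⟨h, hh⟩ := exists_rangeSpace_eq_mul (X := X) (U := U) a b
    exact ⟨h, funext fun z => by simp [m, hh, hb, ha]⟩
  refine dense_closure.1 (denseRange_productMap.mono ?_)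
  rintro _ ⟨t, rfl⟩
  change _ ∈ S.topologicalClosure
  induction t using TensorProduct.induction_on with
  | zero => simp
  | tmul φ ψ => exact hmul φ ψ
  | add s t hs ht => rw [map_add]; exact add_mem hs ht

end

section

variable {F Y : Type*} [NormedAddCommGroup F] [InnerProductSpace ℝ F] [CompleteSpace F]
  [NormedAddCommGroup Y] [InnerProductSpace ℝ Y]

/-- The rank-one operator `v ↦ ⟪y, v⟫ h` is Hilbert–Schmidt, by Bessel's inequality. -/
theorem isHilbertSchmidt_rankOne (y : F) (h : Y) :
    IsHilbertSchmidt ((innerSL ℝ y).smulRight h) := by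
  obtain ⟨s, e, -⟩ := exists_hilbertBasis ℝ F
  refine ⟨s, e, ?_⟩
  have hsum := (e.orthonormal.inner_products_summable (x := y)).mul_right (‖h‖ ^ 2)
  refine hsum.congr fun i => ?_
  simp [norm_smul, mul_pow, real_inner_comm]

/-- A Hilbert–Schmidt operator can take any prescribed value at a nonzero vector. -/
theorem exists_isHilbertSchmidt_apply_eq {y : F} (hy : y ≠ 0) (h : Y) :
    ∃ G : F →L[ℝ] Y, IsHilbertSchmidt G ∧ G y = h := by
  refine ⟨_, isHilbertSchmidt_rankOne y ((‖y‖ ^ 2)⁻¹ • h), ?_⟩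
  have hn : ‖y‖ ^ 2 ≠ 0 := by simpa using hy
  simp [smul_smul, hn]

end

end ControlKoopman

theorem corollary2 {nx nu : ℕ}
    (X : Set (EuclideanSpace ℝ (Fin nx))) [CompactSpace X]
    (U : Set (EuclideanSpace ℝ (Fin nu))) [CompactSpace U]
    (f : X × U → X) (hf : Continuous f)
    (μ' : Measure X) [IsFiniteMeasure μ']
    (ν : Measure (X × U)) [IsFiniteMeasure ν]
    {HX HU : Type*}
    [NormedAddCommGroup HX] [InnerProductSpace ℝ HX] [CompleteSpace HX] [RKHS ℝ HX X ℝ]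
    [NormedAddCommGroup HU] [InnerProductSpace ℝ HU] [CompleteSpace HU] [RKHS ℝ HU U ℝ]
    (hkX : ControlKoopman.HasContinuousKernel HX)
    (hkZ : ControlKoopman.HasContinuousKernel (ControlKoopman.RangeSpace HX HU))
    (hHX : ControlKoopman.IsUniversal HX) (hHU : ControlKoopman.IsUniversal HU)
    (𝒢 : Lp ℝ 2 μ' →ₗ[ℝ] Lp ℝ 2 ν) (h𝒢 : ControlKoopman.IsControlKoopman f μ' ν 𝒢)
    (hbdd : ∃ L : ℝ, ∀ y : Lp ℝ 2 μ', ‖𝒢 y‖ ≤ L * ‖y‖)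
    (y : HX) (ε : ℝ) (hε : 0 < ε) :
    ∃ G : HX →L[ℝ] ControlKoopman.RangeSpace HX HU,
      ControlKoopman.IsHilbertSchmidt G ∧
        ‖𝒢 (ControlKoopman.inclusion μ' hkX y) - ControlKoopman.inclusion ν hkZ (G y)‖ < ε := by
  have hfun : 𝒢 (ControlKoopman.inclusion μ' hkX y) =ᵐ[ν] fun z => y (f z) :=
    h𝒢 y (ControlKoopman.memLp_coe μ' hkX y)
  by_cases hy : y = 0
  · -- No linear operator moves `y = 0`, but then `𝒢 [y] = 0` as well, and `G = 0` is exact.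
    have hG := ControlKoopman.isHilbertSchmidt_rankOne (0 : HX)
      (0 : ControlKoopman.RangeSpace (X := X) (U := U) HX HU)
    exact ⟨_, hG, by simpa [hy] using hε⟩
  · have huniv := ControlKoopman.isUniversal_rangeSpace hkZ hHX hHU
    obtain ⟨h, hh⟩ :=
      huniv.exists_norm_sub_inclusion_lt ν hkZ _ ((hHX.1 y).comp hf) hfun hε
    obtain ⟨G, hG, hGy⟩ := ControlKoopman.exists_isHilbertSchmidt_apply_eq hy h
    exact ⟨G, hG, by rwa [hGy]⟩
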